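/- Let $(R,\mathfrak m)$ be a Noetherian local domain of Krull dimension $1$ which is $\mathfrak m$-adically complete, Gorenstein (i.e. of finite injective dimension as a module over itself) and not regular. Let $Q(R)$ be its field of fractions. Put $R_0=R$ and, inductively, $R_i=\operatorname{End}_{R_{i-1}}(\mathfrak m_{i-1})$ for $i\ge 1$, identified with the subring $\mathfrak m_{i-1}:\mathfrak m_{i-1}=\{x\in Q(R) : x\,\mathfrak m_{i-1}\subseteq\mathfrak m_{i-1}\}$ of $Q(R)$, where $\mathfrak m_{i-1}$ is the maximal ideal of $R_{i-1}$ (each $R_i$ is again a complete local domain). For a commutative Noetherian ring $A$, a finitely generated $A$-module $M$ is called Cohen--Macaulay if $\operatorname{depth} M_{\mathfrak p}\ge\operatorname{ht}\mathfrak p$ for all prime ideals $\mathfrak p$ of $A$ (the zero module having infinite depth), and $\mathsf{CM}(A)$ is the category of these modules. It is of finite type if there is a finitely generated $A$-module $G$ such that $\mathsf{CM}(A)=\operatorname{add}(G)$, the class of modules isomorphic to direct summands of finite direct sums of copies of $G$. Let $\underline{\mathsf{CM}}(R)$ be the stable category of $\mathsf{CM}(R)$: its objects are those of $\mathsf{CM}(R)$,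 and its morphisms are the homomorphisms modulo those that factor through a finitely generated projective module. It is a triangulated category, in which $X[1]\cong Y$ for every exact sequence $0\to X\to P\to Y\to 0$ in $\mathsf{CM}(R)$ with $P$ projective, and whose distinguished triangles are, up to isomorphism, those induced by the short exact sequences in $\mathsf{CM}(R)$. For a class $\mathcal X$ of objects let $\langle\mathcal X\rangle$ be the smallest full subcategory containing $\mathcal X$ and closed under finite direct sums, direct summands and shifts; put $\langle G\rangle_0=0$, and let $\langle G\rangle_{k+1}=\langle\mathcal E_k\rangle$, where $\mathcal E_k$ is the class of the objects $M$ for which there is a distinguished triangle $X\to M\to Y\to X[1]$ with $X\in\langle G\rangle_k$ and $Y\in\langle G\rangle$. The dimension $\dim\underline{\mathsf{CM}}(R)$ (in the sense of Rouquier) is the least integer $d\ge 0$ such that $\underline{\mathsf{CM}}(R)=\langle G\rangle_{d+1}$ for some object $G$, or $\infty$ if there is no such $d$. Let $n\ge 1$ be an integer. If $\mathsf{CM}(R_n)$ is of finite type, then $\dim\underline{\mathsf{CM}}(R)\le n-1$. -/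

import Mathlib

open CategoryTheory CategoryTheory.Limits IsLocalRing

universe u

noncomputable section

namespace CMStable

/-! ### Cohen–Macaulay modules, finite type, Gorenstein local rings -/

/-- The depth of a finitely generated module `M` over a Noetherian local ring `A`: the supremum of
the lengths of the `M`-regular sequences in the maximal ideal. For `M ≠ 0` weakly regular sequences
in the maximal ideal are regular by Nakayama; the zero module gets depth `∞`, as usual. -/
def depth (A : Type u) [CommRing A] [IsLocalRing A] (M : Type u) [AddCommGroup M] [Module A M] :
    ℕ∞ :=
  ⨆ (rs : List A) (_ : (∀ r ∈ rs, r ∈ maximalIdeal A) ∧ RingTheory.Sequence.IsWeaklyRegular M rs),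
    (rs.length : ℕ∞)

/-- A finitely generated `A`-module `M` is (maximal) Cohen–Macaulay if
`depth M_𝔭 ≥ height 𝔭` for every prime ideal `𝔭` of `A`. -/
def isCM (A : Type u) [CommRing A] : ObjectProperty (ModuleCat.{u} A) := fun M =>
  Module.Finite A M ∧
    ∀ (p : Ideal A) [p.IsPrime],
      p.height ≤ depth (Localization.AtPrime p) (LocalizedModule p.primeCompl M)

/-- `M` belongs to `add G`: it is a direct summand of a finite direct sum of copies of `G`. -/
def InAdd {A : Type u} [CommRing A] (G M : ModuleCat.{u} A) : Prop :=
  ∃ (k : ℕ) (N : ModuleCat.{u} A), Nonempty ((M × N) ≃ₗ[A] (Fin k → G))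

/-- `CM(A)` is of finite type: `CM(A) = add G` for some finitely generated `A`-module `G`. -/
def CMFiniteType (A : Type u) [CommRing A] : Prop :=
  ∃ G : ModuleCat.{u} A, Module.Finite A G ∧ ∀ M : ModuleCat.{u} A, isCM A M ↔ InAdd G M

/-- A Noetherian local ring is Gorenstein if it has finite injective dimension as a module over
itself. -/
class IsGorensteinLocalRing (R : Type u) [CommRing R] : Prop
    extends IsLocalRing R, IsNoetherianRing R where
  finite_injectiveDimension : ∃ d : ℕ, HasInjectiveDimensionLE (ModuleCat.of R R) d

/-! ### The iterated endomorphism rings of the maximal ideal -/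

section Endo

variable {R : Type u} [CommRing R] [IsDomain R]

/-- For a local ring `S` with `R ⊆ S ⊆ Q(R)` and maximal ideal `𝔫`, the ring
`𝔫 : 𝔫 = {x ∈ Q(R) | x 𝔫 ⊆ 𝔫}`, which is `End_S(𝔫)` by `endMaxEquiv` below. The maximal ideal is
written as the Jacobson radical, so that locality of `S` is not needed for the definition. -/
def endMax (S : Subalgebra R (FractionRing R)) : Subalgebra R (FractionRing R) where
  carrier := {x | ∀ y ∈ Ring.jacobson S, ∃ z ∈ Ring.jacobson S,
    (z : FractionRing R) = x * (y : FractionRing R)}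
  mul_mem' := by
    intro a b ha hb y hy
    obtain ⟨z, hz, hz'⟩ := hb y hy
    obtain ⟨w, hw, hw'⟩ := ha z hz
    exact ⟨w, hw, by rw [hw', hz', mul_assoc]⟩
  add_mem' := by
    intro a b ha hb y hy
    obtain ⟨z, hz, hz'⟩ := ha y hy
    obtain ⟨w, hw, hw'⟩ := hb y hy
    exact ⟨z + w, add_mem hz hw, by simp [hw', hz', add_mul]⟩
  algebraMap_mem' := by
    intro r y hy
    refine ⟨algebraMap R S r * y, Ideal.mul_mem_left _ _ hy, ?_⟩
    simp

set_option synthInstance.maxHeartbeats 200000 in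
set_option maxHeartbeats 1000000 in
/-- Multiplication by elements of `𝔫 : 𝔫` identifies `𝔫 : 𝔫` with `End_S(𝔫)`, for a local ring `S`
(not a field) between `R` and `Q(R)`. -/
theorem endMaxEquiv (S : Subalgebra R (FractionRing R)) [IsLocalRing S]
    (hS : maximalIdeal S ≠ ⊥) :
    ∃ e : endMax S ≃+* Module.End S (maximalIdeal S),
      ∀ (x : endMax S) (y : maximalIdeal S),
        ((e x y : S) : FractionRing R) = (x : FractionRing R) * ((y : S) : FractionRing R) := by
  have hJ : Ring.jacobson S = maximalIdeal S := IsLocalRing.ringJacobson_eq_maximalIdeal S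
  have hmem : ∀ (x : endMax S) (y : maximalIdeal S), ∃ z : maximalIdeal S,
      ((z : S) : FractionRing R) = (x : FractionRing R) * ((y : S) : FractionRing R) := by
    intro x y
    obtain ⟨z, hz, h⟩ := x.2 y.1 (hJ.ge y.2)
    exact ⟨⟨z, hJ.le hz⟩, h⟩
  choose m hm using hmem
  have hinj : ∀ z w : maximalIdeal S,
      ((z : S) : FractionRing R) = ((w : S) : FractionRing R) → z = w :=
    fun z w h => Subtype.ext (Subtype.ext h)
  let φ : endMax S →+* Module.End S (maximalIdeal S) :=
    { toFun := fun x =>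
        { toFun := m x
          map_add' := fun y z => hinj _ _ (by simp [hm, mul_add])
          map_smul' := fun s y => hinj _ _ (by simp [hm, mul_left_comm]) }
      map_one' := LinearMap.ext fun y => hinj _ _ (by simp [hm])
      map_mul' := fun a b => LinearMap.ext fun y => hinj _ _ (by simp [hm, mul_assoc])
      map_zero' := LinearMap.ext fun y => hinj _ _ (by simp [hm])
      map_add' := fun a b => LinearMap.ext fun y => hinj _ _ (by simp [hm, add_mul]) }
  have hφ : ∀ x y, φ x y = m x y := fun _ _ => rfl
  obtain ⟨y, hy, hy0⟩ := Submodule.exists_mem_ne_zero_of_ne_bot hS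
  have hyK : (y : FractionRing R) ≠ 0 := fun h => hy0 (Subtype.ext h)
  refine ⟨RingEquiv.ofBijective φ ⟨?_, ?_⟩, fun x z => hm x z⟩
  · intro a b hab
    have h := congrArg (fun t : maximalIdeal S => ((t : S) : FractionRing R))
      (LinearMap.congr_fun hab ⟨y, hy⟩)
    simp only [hφ, hm] at h
    exact Subtype.ext (mul_right_cancel₀ hyK h)
  · intro f
    have key : ∀ z : maximalIdeal S, ((f z : S) : FractionRing R) =
        ((f ⟨y, hy⟩ : S) : FractionRing R) / (y : FractionRing R) * ((z : S) : FractionRing R) := by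
      intro z
      have h₁ : y • f z = (z : S) • f ⟨y, hy⟩ := by
        rw [← map_smul, ← map_smul]
        congr 1
        exact Subtype.ext (mul_comm _ _)
      have h₂ := congrArg (fun t : maximalIdeal S => ((t : S) : FractionRing R)) h₁
      simp only [Submodule.coe_smul, smul_eq_mul, MulMemClass.coe_mul] at h₂
      field_simp
      rw [mul_comm, h₂, mul_comm]
    refine ⟨⟨((f ⟨y, hy⟩ : S) : FractionRing R) / (y : FractionRing R), ?_⟩, ?_⟩
    · intro z hz
      exact ⟨f ⟨z, hJ.le hz⟩, hJ.ge (f ⟨z, hJ.le hz⟩).2, key ⟨z, hJ.le hz⟩⟩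
    · exact LinearMap.ext fun z => hinj _ _ (by rw [hφ, hm, key z])

/-- The ring `R_n`: `R_0 = R` and `R_{n+1} = End_{R_n}(𝔪_n)`, realised inside `Q(R)`. -/
def iterEnd (R : Type u) [CommRing R] [IsDomain R] : ℕ → Subalgebra R (FractionRing R)
  | 0 => ⊥
  | n + 1 => endMax (iterEnd R n)

end Endo

/-! ### The stable category of `CM(R)` -/

section Stable

variable (R : Type u) [CommRing R]

/-- The category `CM(R)`, a full subcategory of the category of `R`-modules. -/
abbrev CMCat := (isCM R).FullSubcategory

/-- Two maps of Cohen–Macaulay modules are stably equal if their difference factors through a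
finitely generated projective module. -/
def stableRel : HomRel (CMCat R) := fun X Y f g =>
  ∃ (P : ModuleCat.{u} R) (a : X.obj ⟶ P) (b : P ⟶ Y.obj),
    Module.Finite R P ∧ Module.Projective R P ∧ f.hom - g.hom = a ≫ b

variable {R} in
lemma stableRel_add {X Y : CMCat R} {f₁ f₂ g₁ g₂ : X ⟶ Y}
    (hf : stableRel R f₁ f₂) (hg : stableRel R g₁ g₂) : stableRel R (f₁ + g₁) (f₂ + g₂) := by
  obtain ⟨P, a, b, _, _, h⟩ := hf
  obtain ⟨Q, c, d, _, _, h'⟩ := hg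
  refine ⟨ModuleCat.of R (P × Q), ModuleCat.ofHom (a.hom.prod c.hom),
    ModuleCat.ofHom (b.hom.coprod d.hom), inferInstanceAs (Module.Finite R (P × Q)),
    inferInstanceAs (Module.Projective R (P × Q)), ?_⟩
  have : (f₁ + g₁).hom - (f₂ + g₂).hom = (f₁.hom - f₂.hom) + (g₁.hom - g₂.hom) := by
    change (f₁.hom + g₁.hom) - (f₂.hom + g₂.hom) = _
    abel
  rw [this, h, h']
  ext x
  simp

instance : Congruence (stableRel R) where
  equivalence :=
    { refl := fun f => ⟨ModuleCat.of R PUnit, 0, 0, inferInstanceAs (Module.Finite R PUnit.{u + 1}),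
        inferInstanceAs (Module.Projective R PUnit.{u + 1}), by simp⟩
      symm := by
        rintro f g ⟨P, a, b, h₁, h₂, h⟩
        exact ⟨P, -a, b, h₁, h₂, by rw [Preadditive.neg_comp, ← h, neg_sub]⟩
      trans := by
        intro f g k h₁ h₂
        have h := stableRel_add h₁ h₂
        obtain ⟨P, a, b, h₁, h₂, h⟩ := h
        refine ⟨P, a, b, h₁, h₂, ?_⟩
        rw [← h]
        change _ = (f.hom + g.hom) - (g.hom + k.hom)
        abel }
  comp_left := by
    rintro X Y Z f g g' ⟨P, a, b, h₁, h₂, h⟩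
    exact ⟨P, f.hom ≫ a, b, h₁, h₂, by
      rw [Category.assoc, ← h, Preadditive.comp_sub]; rfl⟩
  comp_right := by
    rintro X Y Z f f' g ⟨P, a, b, h₁, h₂, h⟩
    exact ⟨P, a, b ≫ g.hom, h₁, h₂, by
      rw [← Category.assoc, ← h, Preadditive.sub_comp]; rfl⟩

/-- The stable category of `CM(R)`: the objects are those of `CM(R)`, and morphisms are taken
modulo those that factor through a finitely generated projective module. -/
abbrev StableCM := CategoryTheory.Quotient (stableRel R)

instance : Preadditive (StableCM R) :=
  CategoryTheory.Quotient.preadditive _ (fun _ _ _ _ _ _ hf hg => stableRel_add hf hg)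

/-- The projection functor `CM(R) ⥤ StableCM R`. -/
abbrev proj : CMCat R ⥤ StableCM R := CategoryTheory.Quotient.functor (stableRel R)

variable {R}

/-- The exact structure of `CM(R)`: short exact sequences of modules with all terms in `CM(R)`. -/
def IsConflation (S : ShortComplex (CMCat R)) : Prop :=
  (S.map (isCM R).ι).ShortExact

/-- `Y` is a model of the shift `X[1]` in the stable category: up to isomorphism in the stable
category there is a short exact sequence `0 ⟶ X ⟶ P ⟶ Y ⟶ 0` in `CM(R)` with `P` projective.
For Gorenstein `R` the finitely generated projective modules are the projective-injective objects
of the Frobenius category `CM(R)`, and this determines `X[1]` and `Y[-1]` up to isomorphism. -/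
def IsShift (X Y : StableCM R) : Prop :=
  ∃ S : ShortComplex (CMCat R), IsConflation S ∧ Module.Projective R S.X₂.obj ∧
    Nonempty (X ≅ (proj R).obj S.X₁) ∧ Nonempty (Y ≅ (proj R).obj S.X₃)

/-- `X ⟶ Y ⟶ Z` are the first two maps of a distinguished triangle `X ⟶ Y ⟶ Z ⟶ X[1]` of the
stable category: up to isomorphism these are the images of the short exact sequences
in `CM(R)`. -/
def IsTriangle {X Y Z : StableCM R} (f : X ⟶ Y) (g : Y ⟶ Z) : Prop :=
  ∃ (S : ShortComplex (CMCat R)) (a : X ≅ (proj R).obj S.X₁) (b : Y ≅ (proj R).obj S.X₂)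
    (c : Z ≅ (proj R).obj S.X₃), IsConflation S ∧
      f ≫ b.hom = a.hom ≫ (proj R).map S.f ∧ g ≫ c.hom = b.hom ≫ (proj R).map S.g

/-! ### Rouquier's dimension -/

/-- `⟨𝒳⟩`: the smallest full subcategory of the stable category that contains `𝒳` and is closed
under finite direct sums, direct summands (in particular isomorphisms) and shifts. -/
inductive Gen (𝒳 : ObjectProperty (StableCM R)) : ObjectProperty (StableCM R)
  | of (X : StableCM R) (h : 𝒳 X) : Gen 𝒳 X
  | zero (X : StableCM R) (h : IsZero X) : Gen 𝒳 X
  | sum (X Y : StableCM R) (b : BinaryBicone X Y) (hb : b.IsBilimit) (hX : Gen 𝒳 X)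
      (hY : Gen 𝒳 Y) : Gen 𝒳 b.pt
  | summand (X Y : StableCM R) (b : BinaryBicone X Y) (hb : b.IsBilimit) (h : Gen 𝒳 b.pt) :
      Gen 𝒳 X
  | shift (X Y : StableCM R) (s : IsShift X Y) (h : Gen 𝒳 X) : Gen 𝒳 Y
  | unshift (X Y : StableCM R) (s : IsShift X Y) (h : Gen 𝒳 Y) : Gen 𝒳 X

/-- `𝒳 * 𝒴`: the objects `M` in a distinguished triangle `X ⟶ M ⟶ Y ⟶ X[1]` with `X ∈ 𝒳` and
`Y ∈ 𝒴`. -/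
def star (𝒳 𝒴 : ObjectProperty (StableCM R)) : ObjectProperty (StableCM R) := fun M =>
  ∃ (X Y : StableCM R) (f : X ⟶ M) (g : M ⟶ Y), 𝒳 X ∧ 𝒴 Y ∧ IsTriangle f g

/-- `⟨G⟩_0 = 0` and `⟨G⟩_{k+1} = ⟨⟨G⟩_k * ⟨G⟩⟩`. -/
def level (G : StableCM R) : ℕ → ObjectProperty (StableCM R)
  | 0 => fun X => IsZero X
  | k + 1 => Gen (star (level G k) (Gen (fun X => X = G)))

variable (R) in
/-- The dimension of the stable category of `CM(R)`: the least `d ≥ 0` such that the whole category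
is `⟨G⟩_{d+1}` for some object `G`, and `∞` if there is none. -/
def stableDim : ℕ∞ :=
  ⨅ (d : ℕ) (_ : ∃ G : StableCM R, ∀ X : StableCM R, level G (d + 1) X), (d : ℕ∞)

end Stable

end CMStable

end

/-!
Over `R` every finitely generated torsion-free module `M` satisfies `Ext¹(M, R) = 0` and is
reflexive. If `M` has no free summand, then its functionals take values in the maximal ideal `𝔪`, so
`𝔪 : 𝔪 = R₁` acts on the double dual `M`. Let `M` now be a lattice over `Rᵢ` and let `𝔫` be the
Jacobson radical of `Rᵢ`. Then `𝔫M` is a lattice over `𝔫 : 𝔫 = Rᵢ₊₁` that contains `𝔪M`, and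
`M / 𝔫M` is a power `kˢ` of the residue field. Let `0 → R → L → k → 0` be exact with `L` an ideal.
The fibre product of `M` and `Lˢ` over `kˢ` is an extension of `M` by `Rˢ`, which splits, and also
an extension of `Lˢ` by `𝔫M`; in the stable category this gives a triangle `𝔫M → M → Lˢ`. After
`n - 1` such steps one arrives from `R₁` at lattices over `Rₙ`, which all lie in `add G`; hence
`G ⊕ L` generates the stable category in `n` steps.
-/

noncomputable section

namespace CMStable

/-! ### Extensions and reflexivity over one-dimensional Gorenstein domains -/

section Ext

open Abelian

universe v w

variable {C : Type u} [Category.{v} C] [Abelian C] [HasExt.{w} C] {S : ShortComplex C} {Y : C}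
  {n : ℕ}

lemma subsingleton_ext_middle (hS : S.ShortExact) (h₁ : Subsingleton (Ext S.X₁ Y n))
    (h₃ : Subsingleton (Ext S.X₃ Y n)) : Subsingleton (Ext S.X₂ Y n) := by
  refine subsingleton_of_forall_eq 0 fun x => ?_
  obtain ⟨y, rfl⟩ := Ext.contravariant_sequence_exact₂ hS Y x (h₁.elim _ _)
  rw [h₃.elim y 0, Ext.comp_zero]

lemma subsingleton_ext_right (hS : S.ShortExact) (h₁ : Subsingleton (Ext S.X₁ Y n))
    (h₂ : Subsingleton (Ext S.X₂ Y (n + 1))) : Subsingleton (Ext S.X₃ Y (n + 1)) := by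
  refine subsingleton_of_forall_eq 0 fun x => ?_
  obtain ⟨y, rfl⟩ :=
    Ext.contravariant_sequence_exact₃ hS Y x (h₂.elim _ _) (add_comm 1 n)
  rw [h₁.elim y 0, Ext.comp_zero]

lemma subsingleton_ext_left (hS : S.ShortExact) (h₂ : Subsingleton (Ext S.X₂ Y n))
    (h₃ : Subsingleton (Ext S.X₃ Y (n + 1))) : Subsingleton (Ext S.X₁ Y n) := by
  refine subsingleton_of_forall_eq 0 fun x => ?_
  obtain ⟨y, rfl⟩ := Ext.contravariant_sequence_exact₁ hS Y x (add_comm 1 n) (h₃.elim _ _)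
  rw [h₂.elim y 0, Ext.comp_zero]

lemma subsingleton_ext_of_iso {X X' : C} (e : X ≅ X') (h : Subsingleton (Ext X' Y n)) :
    Subsingleton (Ext X Y n) := by
  refine subsingleton_of_forall_eq 0 fun x => ?_
  rw [← x.mk₀_id_comp, ← e.hom_inv_id, ← Ext.mk₀_comp_mk₀_assoc,
    h.elim ((Ext.mk₀ e.inv).comp x _) 0, Ext.comp_zero]

lemma exists_extension_of_subsingleton_ext (hS : S.ShortExact)
    (h₃ : Subsingleton (Ext S.X₃ Y 1)) (a : S.X₁ ⟶ Y) : ∃ b : S.X₂ ⟶ Y, S.f ≫ b = a := by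
  obtain ⟨y, hy⟩ :=
    Ext.contravariant_sequence_exact₁ hS Y (Ext.mk₀ a) (add_zero 1) (h₃.elim _ _)
  obtain ⟨b, rfl⟩ := Ext.homEquiv₀.symm.surjective y
  rw [Ext.homEquiv₀_symm_apply, Ext.mk₀_comp_mk₀] at hy
  exact ⟨b, Ext.homEquiv₀.symm.injective hy⟩

end Ext

section ExtModule

open Abelian Module

variable {R : Type u} [CommRing R]

lemma shortExact_of_functionExact {M N P : Type u} [AddCommGroup M] [AddCommGroup N]
    [AddCommGroup P] [Module R M] [Module R N] [Module R P] {f : M →ₗ[R] N} {g : N →ₗ[R] P}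
    (hf : Function.Injective f) (hg : Function.Surjective g) (h : Function.Exact f g) :
    (ShortComplex.mk (ModuleCat.ofHom f) (ModuleCat.ofHom g)
      (ModuleCat.hom_ext h.linearMap_comp_eq_zero)).ShortExact where
  exact := (ShortComplex.ShortExact.moduleCat_exact_iff_function_exact _).2 h
  mono_f := (ModuleCat.mono_iff_injective _).2 hf
  epi_g := (ModuleCat.epi_iff_surjective _).2 hg

lemma subsingleton_ext_of_module_projective {M : Type u} [AddCommGroup M] [Module R M]
    [Module.Projective R M] (Y : ModuleCat.{u} R) (n : ℕ) :
    Subsingleton (Ext (ModuleCat.of R M) Y (n + 1)) :=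
  Ext.subsingleton_of_projective _ _ n

lemma exists_injective_residue_quotient [IsLocalRing R] [IsNoetherianRing R]
    [Ring.DimensionLEOne R] {x : R} (hx0 : x ≠ 0) (hx : x ∈ maximalIdeal R) :
    ∃ ι : (R ⧸ maximalIdeal R) →ₗ[R] (R ⧸ Ideal.span {x}), Function.Injective ι := by
  have : Nontrivial (R ⧸ Ideal.span {x}) :=
    Ideal.Quotient.nontrivial_iff.2 (mt Ideal.span_singleton_eq_top.1 hx)
  obtain ⟨p, hp⟩ := associatedPrimes.nonempty R (R ⧸ Ideal.span {x})
  have hxp : x ∈ p := by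
    refine IsAssociatedPrime.annihilator_le hp ?_
    rw [Submodule.annihilator_top, Ideal.annihilator_quotient]
    exact Ideal.mem_span_singleton_self x
  have hp_max : p.IsMaximal := hp.isPrime.isMaximal (Submodule.ne_bot_iff _ |>.2 ⟨x, hxp, hx0⟩)
  obtain rfl := IsLocalRing.eq_maximalIdeal hp_max
  exact (isAssociatedPrime_iff_exists_injective_linearMap _ _).1 hp |>.2

lemma exists_ne_zero_mem_maximalIdeal [IsLocalRing R] (hR : ¬ IsField R) :
    ∃ x ∈ maximalIdeal R, x ≠ 0 :=
  Submodule.exists_mem_ne_zero_of_ne_bot (mt IsLocalRing.isField_iff_maximalIdeal_eq.2 hR)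

lemma subsingleton_ext_quotient_span_singleton [IsDomain R] {x : R} (hx : x ≠ 0)
    (Y : ModuleCat.{u} R) (n : ℕ) :
    Subsingleton (Ext (ModuleCat.of R (R ⧸ Ideal.span {x})) Y (n + 2)) := by
  have hexact : Function.Exact (LinearMap.lsmul R R x) (Ideal.span {x}).mkQ := fun r => by
    rw [Submodule.mkQ_apply, Submodule.Quotient.mk_eq_zero, Ideal.mem_span_singleton]
    exact exists_congr fun c => eq_comm
  exact subsingleton_ext_right
    (shortExact_of_functionExact (smul_right_injective R hx) (Submodule.mkQ_surjective _) hexact)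
    (subsingleton_ext_of_module_projective Y n) (subsingleton_ext_of_module_projective Y (n + 1))

variable [IsLocalRing R] [IsNoetherianRing R] [Ring.DimensionLEOne R]

lemma subsingleton_ext_of_residue {Y : ModuleCat.{u} R} {n : ℕ}
    (h : Subsingleton (Ext (ModuleCat.of R (R ⧸ maximalIdeal R)) Y (n + 1)))
    (M : Type u) [AddCommGroup M] [Module R M] [hM : Module.Finite R M] :
    Subsingleton (Ext (ModuleCat.of R M) Y (n + 1)) := by
  induction hM using IsNoetherianRing.induction_on_isQuotientEquivQuotientPrime R with
  | subsingleton N => exact subsingleton_ext_of_module_projective Y n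
  | quotient N p e =>
    by_cases hp : p.1 = ⊥
    · exact subsingleton_ext_of_iso (e.trans (Submodule.quotEquivOfEqBot _ hp)).toModuleIso
        (subsingleton_ext_of_module_projective Y n)
    · have hp_max := IsLocalRing.eq_maximalIdeal (p.2.isMaximal hp)
      exact subsingleton_ext_of_iso (e.trans (Submodule.quotEquivOfEq _ _ hp_max)).toModuleIso h
  | exact N₁ N₂ N₃ f g hf hg hfg h₁ h₃ =>
    exact subsingleton_ext_middle (shortExact_of_functionExact hf hg hfg) h₁ h₃

/- The residue field embeds in `R ⧸ (x)`, whose higher `Ext` vanish, so that vanishing of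
`Ext^(j+1)` on all finitely generated modules descends to `Ext^j`, as long as `2 ≤ j`. -/
lemma subsingleton_ext_add_two [IsDomain R] (hR : ¬ IsField R) {Y : ModuleCat.{u} R} {d : ℕ}
    (hY : HasInjectiveDimensionLE Y d) (n : ℕ) (M : Type u) [AddCommGroup M] [Module R M]
    [Module.Finite R M] : Subsingleton (Ext (ModuleCat.of R M) Y (n + 2)) := by
  induction hk : d - n generalizing n M with
  | zero => exact hY.subsingleton _ _ _ (by lia) _
  | succ k ih =>
    obtain ⟨x, hx, hx0⟩ := exists_ne_zero_mem_maximalIdeal hR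
    obtain ⟨ι, hι⟩ := exists_injective_residue_quotient hx0 hx
    exact subsingleton_ext_of_residue (subsingleton_ext_left
      (shortExact_of_functionExact hι (Submodule.mkQ_surjective (LinearMap.range ι))
        (LinearMap.exact_map_mkQ_range ι))
      (subsingleton_ext_quotient_span_singleton hx0 Y n)
      (ih (n + 1) _ (by lia))) M

end ExtModule

section TorsionFree

open Module

variable {R : Type u} [CommRing R] [IsDomain R] {M : Type*} [AddCommGroup M] [Module R M]

lemma exists_linearIndepOn_smul_mem_span {ι : Type*} [Finite ι] {s : ι → M}
    (hs : Submodule.span R (Set.range s) = ⊤) :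
    ∃ (I : Set ι) (a : R), LinearIndepOn R s I ∧ a ≠ 0 ∧
      ∀ x, a • x ∈ Submodule.span R (s '' I) := by
  classical
  have := Fintype.ofFinite ι
  obtain ⟨I, hI, hmax⟩ := exists_maximal_linearIndepOn R s
  have hmul : ∀ i, ∃ a : R, a ≠ 0 ∧ a • s i ∈ Submodule.span R (s '' I) := fun i => by
    by_cases hi : i ∈ I
    · exact ⟨1, one_ne_zero, by simpa using Submodule.subset_span (Set.mem_image_of_mem s hi)⟩
    · exact hmax i hi
  choose a ha hmem using hmul
  have hle : Submodule.map (LinearMap.lsmul R M (∏ i, a i)) ⊤ ≤ Submodule.span R (s '' I) := by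
    rw [← hs, Submodule.map_span_le]
    rintro _ ⟨i, rfl⟩
    rw [LinearMap.lsmul_apply, Fintype.prod_eq_prod_compl_mul i, mul_smul]
    exact Submodule.smul_mem _ _ (hmem i)
  exact ⟨I, ∏ i, a i, hI, Finset.prod_ne_zero_iff.2 fun i _ => ha i,
    fun x => hle (Submodule.mem_map_of_mem Submodule.mem_top)⟩

variable [Module.Finite R M] [IsTorsionFree R M]

variable (R M) in
lemma exists_injective_fin_pi : ∃ (n : ℕ) (f : M →ₗ[R] (Fin n → R)), Function.Injective f := by
  obtain ⟨k, s, hs⟩ := Module.Finite.exists_fin (R := R) (M := M)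
  obtain ⟨I, a, hI, ha, hmem⟩ := exists_linearIndepOn_smul_mem_span hs
  have := Fintype.ofFinite I
  rw [Set.image_eq_range] at hmem
  let b := (Basis.span hI).reindex (Fintype.equivFin I)
  exact ⟨_, b.equivFun.toLinearMap ∘ₗ (LinearMap.lsmul R M a).codRestrict _ hmem,
    b.equivFun.injective.comp
      ((LinearMap.injective_codRestrict_iff _).2 (smul_right_injective M ha))⟩

lemma injective_dual_eval : Function.Injective (Dual.eval R M) := by
  obtain ⟨n, f, hf⟩ := exists_injective_fin_pi R M
  refine (injective_iff_map_eq_zero _).2 fun x hx => hf ?_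
  ext i
  simpa using LinearMap.congr_fun hx (LinearMap.proj i ∘ₗ f)

variable [IsLocalRing R] [IsNoetherianRing R] [Ring.DimensionLEOne R]

open Abelian in
lemma subsingleton_ext_one_of_isTorsionFree (hR : ¬ IsField R) {Y : ModuleCat.{u} R} {d : ℕ}
    (hY : HasInjectiveDimensionLE Y d) (M : Type u) [AddCommGroup M] [Module R M]
    [Module.Finite R M] [IsTorsionFree R M] : Subsingleton (Ext (ModuleCat.of R M) Y 1) := by
  obtain ⟨n, f, hf⟩ := exists_injective_fin_pi R M
  exact subsingleton_ext_left (shortExact_of_functionExact hf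
      (Submodule.mkQ_surjective (LinearMap.range f)) (LinearMap.exact_map_mkQ_range f))
    (subsingleton_ext_of_module_projective Y 0) (subsingleton_ext_add_two hR hY 0 _)

end TorsionFree

section Gorenstein

open Module

variable {R : Type u} [CommRing R]

lemma exact_dualMap {M N P : Type*} [AddCommGroup M] [AddCommGroup N] [AddCommGroup P]
    [Module R M] [Module R N] [Module R P] {f : M →ₗ[R] N} {g : N →ₗ[R] P}
    (hg : Function.Surjective g) (h : Function.Exact f g) :
    Function.Exact g.dualMap f.dualMap := by
  rw [LinearMap.exact_iff, LinearMap.ker_dualMap_eq_dualAnnihilator_range,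
    LinearMap.range_dualMap_eq_dualAnnihilator_ker_of_surjective g hg,
    LinearMap.exact_iff.1 h]

variable [IsDomain R] [IsGorensteinLocalRing R] [Ring.DimensionLEOne R]
  {M N P : Type u} [AddCommGroup M] [AddCommGroup N] [AddCommGroup P] [Module R M] [Module R N]
  [Module R P] {f : M →ₗ[R] N} {g : N →ₗ[R] P} [Module.Finite R P] [IsTorsionFree R P]

lemma surjective_dualMap_of_isTorsionFree (hR : ¬ IsField R) (hf : Function.Injective f)
    (hg : Function.Surjective g) (h : Function.Exact f g) : Function.Surjective f.dualMap := by
  intro a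
  obtain ⟨d, hd⟩ := IsGorensteinLocalRing.finite_injectiveDimension (R := R)
  obtain ⟨b, hb⟩ := exists_extension_of_subsingleton_ext (shortExact_of_functionExact hf hg h)
    (subsingleton_ext_one_of_isTorsionFree hR hd P) (ModuleCat.ofHom a)
  exact ⟨b.hom, congrArg ModuleCat.Hom.hom hb⟩

/- Dualising `0 → K → R^n → M → 0` twice leaves it exact, and `R^n` is reflexive. -/
lemma isReflexive_of_isTorsionFree (hR : ¬ IsField R) (M : Type u) [AddCommGroup M] [Module R M]
    [Module.Finite R M] [IsTorsionFree R M] : IsReflexive R M := by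
  obtain ⟨n, p, hp⟩ := Module.Finite.exists_fin' R M
  have hexact := LinearMap.exact_subtype_ker_map p
  have hsurj :=
    surjective_dualMap_of_isTorsionFree hR (Submodule.injective_subtype _) hp hexact
  have : Module.Finite R (Dual R (LinearMap.ker p)) := Module.Finite.of_surjective _ hsurj
  have hsurj' : Function.Surjective p.dualMap.dualMap :=
    surjective_dualMap_of_isTorsionFree hR (LinearMap.dualMap_injective_of_surjective hp) hsurj
      (exact_dualMap hp hexact)
  refine ⟨injective_dual_eval, ?_⟩
  have hcomp : Dual.eval R M ∘ p = p.dualMap.dualMap ∘ Dual.eval R (Fin n → R) := rfl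
  exact .of_comp (hcomp ▸ hsurj'.comp (bijective_dual_eval R _).2)

/- A retraction `N → R^n` is found one coordinate at a time. -/
lemma nonempty_linearEquiv_prod_of_exact {n : ℕ} (hR : ¬ IsField R) {f : (Fin n → R) →ₗ[R] N}
    (hf : Function.Injective f) (hg : Function.Surjective g) (h : Function.Exact f g) :
    Nonempty (N ≃ₗ[R] (Fin n → R) × P) := by
  choose ρ hρ using fun i => surjective_dualMap_of_isTorsionFree hR hf hg h (LinearMap.proj i)
  have hretract : LinearMap.pi ρ ∘ₗ f = LinearMap.id :=
    LinearMap.ext fun x => funext fun i => LinearMap.congr_fun (hρ i) x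
  exact ⟨(h.splitInjectiveEquiv hg ⟨LinearMap.pi ρ, hretract⟩).1⟩

end Gorenstein

/-! ### Cohen–Macaulay modules over one-dimensional domains -/

section CohenMacaulay

variable {A : Type u} [CommRing A]

lemma exists_isSMulRegular_of_one_le_depth [IsLocalRing A] {M : Type u} [AddCommGroup M]
    [Module A M] (h : 1 ≤ depth A M) : ∃ x ∈ maximalIdeal A, IsSMulRegular M x := by
  by_contra! hreg
  have hdepth : depth A M ≤ 0 := iSup₂_le fun rs hrs => by
    rcases rs with _ | ⟨x, rs⟩
    · simp
    · exact (hreg x (hrs.1 x (by simp))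
        ((RingTheory.Sequence.isWeaklyRegular_cons_iff M x rs).1 hrs.2).1).elim
  exact absurd (h.trans hdepth) (by simp)

lemma exists_dvd_pow_of_mem_maximalIdeal [IsLocalRing A] [Ring.DimensionLEOne A] {c x : A}
    (hc : c ≠ 0) (hx : x ∈ maximalIdeal A) : ∃ k, c ∣ x ^ k := by
  have hrad : x ∈ (Ideal.span {c}).radical := by
    rw [Ideal.radical_eq_sInf, Ideal.mem_sInf]
    rintro q ⟨hcq, hq⟩
    have hq0 : q ≠ ⊥ := by
      rintro rfl
      exact hc (by simpa using hcq)
    rwa [IsLocalRing.eq_maximalIdeal (hq.isMaximal hq0)]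
  exact hrad.imp fun k hk => Ideal.mem_span_singleton.1 hk

lemma eq_zero_of_smul_eq_zero_of_one_le_depth [IsLocalRing A] [Ring.DimensionLEOne A]
    {M : Type u} [AddCommGroup M] [Module A M] (hM : 1 ≤ depth A M) {c : A} (hc : c ≠ 0) {v : M}
    (hv : c • v = 0) : v = 0 := by
  obtain ⟨x, hx, hreg⟩ := exists_isSMulRegular_of_one_le_depth hM
  obtain ⟨k, d, hd⟩ := exists_dvd_pow_of_mem_maximalIdeal hc hx
  refine isSMulRegular_iff_right_eq_zero_of_smul.1 (hreg.pow k) v ?_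
  rw [hd, mul_comm, mul_smul, hv, smul_zero]

lemma one_le_depth_localization [IsDomain A] {p : Ideal A} [p.IsPrime] (hp : p ≠ ⊥) (M : Type u)
    [AddCommGroup M] [Module A M] [Module.IsTorsionFree A M] :
    1 ≤ depth (Localization.AtPrime p) (LocalizedModule p.primeCompl M) := by
  obtain ⟨x, hx, hx0⟩ := Submodule.exists_mem_ne_zero_of_ne_bot hp
  refine le_iSup₂_of_le [algebraMap A (Localization.AtPrime p) x] ⟨?_, ?_⟩ (by simp)
  · exact List.forall_mem_singleton.2 ((IsLocalization.AtPrime.to_map_mem_maximal_iff _ p x).2 hx)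
  · exact RingTheory.Sequence.IsWeaklyRegular.of_isLocalizedModule (rs := [x])
      (Localization.AtPrime p) p.primeCompl (LocalizedModule.mkLinearMap p.primeCompl M)
      (by simpa using IsSMulRegular.of_ne_zero hx0)

variable [IsDomain A] [Ring.DimensionLEOne A]

lemma isCM_of_isTorsionFree (M : Type u) [AddCommGroup M] [Module A M] [Module.Finite A M]
    [Module.IsTorsionFree A M] : isCM A (ModuleCat.of A M) := by
  refine ⟨‹_›, fun p _ => ?_⟩
  by_cases hp : p = ⊥
  · subst hp
    simp
  · have hp1 : p.height ≤ 1 := WithBot.coe_le_coe.1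
      (Ideal.height_le_ringKrullDim_of_isPrime.trans (Ring.krullDimLE_iff.1 inferInstance))
    exact hp1.trans (one_le_depth_localization hp M)

lemma isTorsionFree_of_isCM {M : ModuleCat.{u} A} (hM : isCM A M) :
    Module.IsTorsionFree A M := by
  by_cases hA : IsField A
  · let := hA.toField
    infer_instance
  refine ⟨fun c hc => isSMulRegular_iff_right_eq_zero_of_smul.2 fun v hv => ?_⟩
  refine Module.eq_zero_of_localization_maximal
    (fun (P : Ideal A) _ => LocalizedModule P.primeCompl M)
    (fun (P : Ideal A) _ => LocalizedModule.mkLinearMap P.primeCompl M) v fun p hp => ?_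
  have hp0 : p ≠ ⊥ := Ring.ne_bot_of_isMaximal_of_not_isField hp hA
  have hle : p.primeCompl ≤ nonZeroDivisors A := p.primeCompl_le_nonZeroDivisors
  have : IsDomain (Localization.AtPrime p) := IsLocalization.isDomain_localization hle
  have : Ring.DimensionLEOne (Localization.AtPrime p) :=
    Ring.DimensionLEOne.localization (M := p.primeCompl) _ hle
  have hht : 1 ≤ p.height := Order.one_le_iff_ne_zero.2 (mt Ideal.height_eq_zero_iff_eq_bot.1 hp0)
  have hc0 : algebraMap A (Localization.AtPrime p) c ≠ 0 := fun h => hc.ne_zero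
    (IsLocalization.injective _ hle (h.trans (map_zero _).symm))
  refine eq_zero_of_smul_eq_zero_of_one_le_depth (hht.trans (hM.2 p)) hc0 ?_
  rw [algebraMap_smul, ← map_smul, hv, map_zero]

lemma isCM_iff {M : ModuleCat.{u} A} :
    isCM A M ↔ Module.Finite A M ∧ Module.IsTorsionFree A M :=
  ⟨fun hM => ⟨hM.1, isTorsionFree_of_isCM hM⟩, fun ⟨_, _⟩ => isCM_of_isTorsionFree M⟩

end CohenMacaulay

/-! ### Exact sequences and levels in the stable category -/

section Splitting

variable {R : Type u} [CommRing R]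

lemma exists_linearEquiv_pi_quotient (I : Ideal R) [I.IsMaximal] {Q : Type*} [AddCommGroup Q]
    [Module R Q] [Module.Finite R Q] (h : ∀ r ∈ I, ∀ x : Q, r • x = 0) :
    ∃ s : ℕ, Nonempty (Q ≃ₗ[R] (Fin s → R ⧸ I)) := by
  have htorsion : Module.IsTorsionBySet R Q I := fun x r => h r r.2 x
  let := Ideal.Quotient.field I
  let : Module (R ⧸ I) Q := htorsion.module
  have : IsScalarTower R (R ⧸ I) Q := htorsion.isScalarTower
  have : Module.Finite (R ⧸ I) Q := Module.Finite.of_restrictScalars_finite R (R ⧸ I) Q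
  exact ⟨_, ⟨(Module.finBasis (R ⧸ I) Q).equivFun.restrictScalars R⟩⟩

lemma nonempty_linearEquiv_ker_prod {M P : Type*} [AddCommGroup M] [AddCommGroup P]
    [Module R M] [Module R P] [Module.Projective R P] {g : M →ₗ[R] P}
    (hg : Function.Surjective g) : Nonempty (M ≃ₗ[R] LinearMap.ker g × P) := by
  obtain ⟨l, hl⟩ := Module.projective_lifting_property g LinearMap.id hg
  exact ⟨((LinearMap.exact_subtype_ker_map g).splitSurjectiveEquiv
    (Submodule.injective_subtype _) ⟨l, hl⟩).1⟩

/- The free summand is the target of a surjection onto a free module of largest possible rank. -/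
lemma exists_linearEquiv_prod_pi [Nontrivial R] (M : Type*) [AddCommGroup M] [Module R M]
    [Module.Finite R M] : ∃ (r : ℕ) (N : Submodule R M),
      (∀ f : N →ₗ[R] R, ¬ Function.Surjective f) ∧ Nonempty (M ≃ₗ[R] N × (Fin r → R)) := by
  let ranks : Set ℕ := {r | ∃ g : M →ₗ[R] (Fin r → R), Function.Surjective g}
  have hne : ranks.Nonempty := ⟨0, 0, Function.surjective_to_subsingleton _⟩
  have hbdd : BddAbove ranks := by
    obtain ⟨n, p, hp⟩ := Module.Finite.exists_fin' R M
    exact ⟨n, fun r ⟨g, hg⟩ => le_of_fin_surjective R (g ∘ₗ p) (hg.comp hp)⟩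
  obtain ⟨g, hg⟩ : sSup ranks ∈ ranks := Nat.sSup_mem hne hbdd
  obtain ⟨e⟩ := nonempty_linearEquiv_ker_prod hg
  refine ⟨sSup ranks, LinearMap.ker g, fun f hf => ?_, ⟨e⟩⟩
  let c := Fin.consLinearEquiv R fun _ : Fin (sSup ranks + 1) => R
  have hsucc : sSup ranks + 1 ∈ ranks :=
    ⟨c.toLinearMap ∘ₗ f.prodMap LinearMap.id ∘ₗ e.toLinearMap,
      c.surjective.comp ((Prod.map_surjective.2 ⟨hf, Function.surjective_id⟩).comp e.surjective)⟩
  exact Nat.not_succ_le_self _ (le_csSup hbdd hsucc)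

lemma exact_compLeft {A B C : Type*} [AddCommGroup A] [AddCommGroup B] [AddCommGroup C]
    [Module R A] [Module R B] [Module R C] {f : A →ₗ[R] B} {g : B →ₗ[R] C}
    (h : Function.Exact f g) (ι : Type*) : Function.Exact (f.compLeft ι) (g.compLeft ι) := by
  rw [LinearMap.exact_iff, LinearMap.ker_compLeft, LinearMap.range_compLeft,
    LinearMap.exact_iff.1 h]

end Splitting

section Pullback

variable {R : Type u} [CommRing R] {K M P Q : Type*} [AddCommGroup K] [AddCommGroup M]
  [AddCommGroup P] [AddCommGroup Q] [Module R K] [Module R M] [Module R P] [Module R Q]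

/-- The fibre product of two linear maps with the same target. -/
def fiberProduct (p : M →ₗ[R] Q) (π : P →ₗ[R] Q) : Submodule R (M × P) :=
  LinearMap.eqLocus (p ∘ₗ LinearMap.fst R M P) (π ∘ₗ LinearMap.snd R M P)

/-- The projection of a fibre product to its first factor. -/
def fiberProductFst (p : M →ₗ[R] Q) (π : P →ₗ[R] Q) : fiberProduct p π →ₗ[R] M :=
  LinearMap.fst R M P ∘ₗ (fiberProduct p π).subtype

variable {p : M →ₗ[R] Q} {π : P →ₗ[R] Q}

lemma nonempty_fiberProduct_linearEquiv_swap : Nonempty (fiberProduct p π ≃ₗ[R] fiberProduct π p) :=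
  ⟨(LinearEquiv.prodComm R M P).ofSubmodules _ _ (by
    ext x
    simp [fiberProduct, LinearMap.mem_eqLocus, eq_comm])⟩

lemma surjective_fiberProductFst (hπ : Function.Surjective π) :
    Function.Surjective (fiberProductFst p π) := fun m => by
  obtain ⟨x, hx⟩ := hπ (p m)
  exact ⟨⟨(m, x), hx.symm⟩, rfl⟩

lemma exists_exact_fiberProductFst {i : K →ₗ[R] P} (hi : Function.Injective i)
    (h : Function.Exact i π) : ∃ j : K →ₗ[R] fiberProduct p π,
      Function.Injective j ∧ Function.Exact j (fiberProductFst p π) := by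
  let j : K →ₗ[R] fiberProduct p π := (LinearMap.inr R M P ∘ₗ i).codRestrict _ fun x =>
    (map_zero p).trans (h.apply_apply_eq_zero x).symm
  refine ⟨j, fun x y hxy => hi (congrArg (fun z : fiberProduct p π => z.1.2) hxy), ?_⟩
  rintro ⟨⟨m, x⟩, hmx⟩
  constructor
  · rintro (rfl : m = 0)
    obtain ⟨y, rfl⟩ := (h x).1 ((Eq.symm hmx).trans (map_zero p))
    exact ⟨y, rfl⟩
  · rintro ⟨y, hy⟩
    exact (congrArg (fun z : fiberProduct p π => z.1.1) hy).symm

/- The fibre product of `M` and `P` over `Q` is an extension of `P` by `N`, and it is also a split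
extension of `M` by the free module. -/
lemma exists_exact_of_pi_resolution [IsDomain R] [IsGorensteinLocalRing R]
    [Ring.DimensionLEOne R] (hR : ¬ IsField R) {M N P : Type u} [AddCommGroup M] [AddCommGroup N]
    [AddCommGroup P] [Module R M] [Module R N] [Module R P] [Module.Finite R M]
    [Module.IsTorsionFree R M] {s : ℕ} {j : N →ₗ[R] M} {p : M →ₗ[R] Q} {i : (Fin s → R) →ₗ[R] P}
    {π : P →ₗ[R] Q} (hj : Function.Injective j) (hp : Function.Surjective p)
    (hjp : Function.Exact j p) (hi : Function.Injective i) (hπ : Function.Surjective π)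
    (hiπ : Function.Exact i π) :
    ∃ (f : N →ₗ[R] (Fin s → R) × M) (g : (Fin s → R) × M →ₗ[R] P),
      Function.Injective f ∧ Function.Surjective g ∧ Function.Exact f g := by
  obtain ⟨i', hi', hexact⟩ := exists_exact_fiberProductFst (p := p) hi hiπ
  obtain ⟨e⟩ := nonempty_linearEquiv_prod_of_exact hR hi' (surjective_fiberProductFst hπ) hexact
  obtain ⟨σ⟩ := nonempty_fiberProduct_linearEquiv_swap (p := π) (π := p)
  obtain ⟨j', hj', hexact'⟩ := exists_exact_fiberProductFst (p := π) hj hjp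
  let e' := σ.trans e
  refine ⟨e'.toLinearMap ∘ₗ j', fiberProductFst π p ∘ₗ e'.symm.toLinearMap, e'.injective.comp hj',
    (surjective_fiberProductFst hp).comp e'.symm.surjective, ?_⟩
  exact (LinearEquiv.conj_exact_iff_exact j' (fiberProductFst π p) e').2 hexact'

end Pullback

section StableCategory

variable {R : Type u} [CommRing R] {X Y Z : CMCat R}

instance : (proj R).Additive :=
  CategoryTheory.Quotient.functor_additive _ fun _ _ _ _ _ _ hf hg => stableRel_add hf hg

lemma isZero_proj_of_projective (X : CMCat R) [Module.Projective R X.obj] :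
    IsZero ((proj R).obj X) := by
  rw [IsZero.iff_id_eq_zero, ← (proj R).map_id, ← (proj R).map_zero]
  exact CategoryTheory.Quotient.sound _
    ⟨X.obj, 𝟙 _, 𝟙 _, X.property.1, ‹_›, by simp⟩

/-- The bicone in `CM(R)` given by a direct sum decomposition of the underlying module. -/
def directSumBicone (e : Z.obj ≃ₗ[R] X.obj × Y.obj) : BinaryBicone X Y where
  pt := Z
  fst := ObjectProperty.homMk (ModuleCat.ofHom (LinearMap.fst R _ _ ∘ₗ e.toLinearMap))
  snd := ObjectProperty.homMk (ModuleCat.ofHom (LinearMap.snd R _ _ ∘ₗ e.toLinearMap))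
  inl := ObjectProperty.homMk (ModuleCat.ofHom (e.symm.toLinearMap ∘ₗ LinearMap.inl R _ _))
  inr := ObjectProperty.homMk (ModuleCat.ofHom (e.symm.toLinearMap ∘ₗ LinearMap.inr R _ _))
  inl_fst := by ext; simp
  inl_snd := by ext; simp
  inr_fst := by ext; simp
  inr_snd := by ext; simp

lemma nonempty_isBilimit_map_directSumBicone (e : Z.obj ≃ₗ[R] X.obj × Y.obj) :
    Nonempty ((proj R).mapBinaryBicone (directSumBicone e)).IsBilimit := by
  have htotal : (directSumBicone e).fst ≫ (directSumBicone e).inl +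
      (directSumBicone e).snd ≫ (directSumBicone e).inr = 𝟙 (directSumBicone e).pt := by
    ext x
    refine e.injective ?_
    change e (e.symm ((e x).1, 0) + e.symm (0, (e x).2)) = e x
    simp
  have := preservesBinaryBiproducts_of_preservesBiproducts (proj R)
  exact ⟨isBinaryBilimitOfPreserves (proj R) (isBinaryBilimitOfTotal _ htotal)⟩

variable {𝒳 : ObjectProperty (StableCM R)} {G : StableCM R} {k : ℕ}

lemma Gen.of_prod (e : Z.obj ≃ₗ[R] X.obj × Y.obj) (h : Gen 𝒳 ((proj R).obj Z)) :
    Gen 𝒳 ((proj R).obj X) :=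
  (nonempty_isBilimit_map_directSumBicone e).elim fun hb => Gen.summand _ _ _ hb h

lemma Gen.prod (e : Z.obj ≃ₗ[R] X.obj × Y.obj) (hX : Gen 𝒳 ((proj R).obj X))
    (hY : Gen 𝒳 ((proj R).obj Y)) : Gen 𝒳 ((proj R).obj Z) :=
  (nonempty_isBilimit_map_directSumBicone e).elim fun hb => Gen.sum _ _ _ hb hX hY

lemma level_succ_of_exact {f : X.obj →ₗ[R] Y.obj} {g : Y.obj →ₗ[R] Z.obj}
    (hf : Function.Injective f) (hg : Function.Surjective g) (h : Function.Exact f g)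
    (hX : level G k ((proj R).obj X)) (hZ : Gen (fun X => X = G) ((proj R).obj Z)) :
    level G (k + 1) ((proj R).obj Y) := by
  let S : ShortComplex (CMCat R) := ShortComplex.mk (ObjectProperty.homMk (ModuleCat.ofHom f))
    (ObjectProperty.homMk (ModuleCat.ofHom g))
    (by ext x; exact h.apply_apply_eq_zero x)
  have hS : IsConflation S := shortExact_of_functionExact hf hg h
  exact Gen.of _ ⟨_, _, (proj R).map S.f, (proj R).map S.g, hX, hZ, S, Iso.refl _, Iso.refl _,
    Iso.refl _, hS, by simp, by simp⟩

end StableCategory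

section Levels

open Module

variable {R : Type u} [CommRing R] [IsDomain R] [Ring.DimensionLEOne R]

variable (R) in
/-- A finitely generated torsion-free module as an object of `CM(R)`. -/
abbrev toCM (M : Type u) [AddCommGroup M] [Module R M] [Module.Finite R M]
    [IsTorsionFree R M] : CMCat R :=
  ⟨ModuleCat.of R M, isCM_of_isTorsionFree M⟩

variable (R) in
/-- A finitely generated torsion-free module as an object of the stable category. -/
abbrev toStable (M : Type u) [AddCommGroup M] [Module R M] [Module.Finite R M]
    [IsTorsionFree R M] : StableCM R :=
  (proj R).obj (toCM R M)

variable {M N G L : Type u} [AddCommGroup M] [AddCommGroup N] [AddCommGroup G] [AddCommGroup L]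
  [Module R M] [Module R N] [Module R G] [Module R L] [Module.Finite R M] [Module.Finite R N]
  [Module.Finite R G] [Module.Finite R L] [IsTorsionFree R M] [IsTorsionFree R N]
  [IsTorsionFree R G] [IsTorsionFree R L] {𝒳 : ObjectProperty (StableCM R)} {H : StableCM R}
  {k : ℕ}

lemma isZero_toStable_of_projective [Module.Projective R M] : IsZero (toStable R M) :=
  have : Module.Projective R (toCM R M).obj := ‹_›
  isZero_proj_of_projective _

lemma Gen.pi (h : Gen 𝒳 (toStable R G)) (k : ℕ) : Gen 𝒳 (toStable R (Fin k → G)) := by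
  induction k with
  | zero => exact Gen.zero _ isZero_toStable_of_projective
  | succ k ih =>
    exact Gen.prod (X := toCM R G) (Y := toCM R (Fin k → G))
      (Fin.consLinearEquiv R fun _ : Fin (k + 1) => G).symm h ih

lemma Gen.of_inAdd (hM : InAdd (ModuleCat.of R G) (ModuleCat.of R M))
    (h : Gen 𝒳 (toStable R G)) : Gen 𝒳 (toStable R M) := by
  obtain ⟨k, N, ⟨e⟩⟩ := hM
  have : Module.Finite R N := Module.Finite.of_surjective
    (LinearMap.snd R M N ∘ₗ e.symm.toLinearMap) (Prod.snd_surjective.comp e.symm.surjective)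
  have : IsTorsionFree R N := (e.injective.comp LinearMap.inr_injective).moduleIsTorsionFree
    (e.toLinearMap ∘ₗ LinearMap.inr R M N) (map_smul _)
  exact Gen.of_prod (X := toCM R M) (Y := toCM R N) e.symm (h.pi k)

lemma level_one_of_gen (h : Gen (fun X => X = H) (toStable R M)) : level H 1 (toStable R M) :=
  level_succ_of_exact (X := toCM R PUnit) (Y := toCM R M) (Z := toCM R M) (f := 0)
    (g := LinearMap.id) (Function.injective_of_subsingleton _) Function.surjective_id
    ((LinearMap.exact_zero_iff_injective _ _).2 Function.injective_id)
    isZero_toStable_of_projective h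

/-- `L` is an extension of the residue field of `R` by the free module `R`. -/
def IsResidueExtension (R L : Type u) [CommRing R] [IsLocalRing R] [AddCommGroup L] [Module R L] :
    Prop :=
  ∃ (i : R →ₗ[R] L) (q : L →ₗ[R] R ⧸ maximalIdeal R),
    Function.Injective i ∧ Function.Surjective q ∧ Function.Exact i q

lemma exists_ideal_isResidueExtension [IsLocalRing R] [IsNoetherianRing R] (hR : ¬ IsField R) :
    ∃ L : Ideal R, IsResidueExtension R L := by
  obtain ⟨x, hx, hx0⟩ := exists_ne_zero_mem_maximalIdeal hR
  obtain ⟨ι, hι⟩ := exists_injective_residue_quotient hx0 hx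
  let mk := (Ideal.span {x}).mkQ
  have hker : ∀ r, mk r = 0 ↔ x ∣ r := fun r => by
    rw [Submodule.mkQ_apply, Submodule.Quotient.mk_eq_zero, Ideal.mem_span_singleton]
  let L : Ideal R := (LinearMap.range ι).comap mk
  let i : R →ₗ[R] L := (LinearMap.toSpanSingleton R R x).codRestrict L fun r =>
    ⟨0, (map_zero ι).trans ((hker _).2 (Dvd.intro_left r rfl)).symm⟩
  let e := LinearEquiv.ofInjective ι hι
  let q' : L →ₗ[R] LinearMap.range ι := mk.restrict fun _ h => h
  have hq' : Function.Surjective q' := fun ⟨y, hy⟩ => by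
    obtain ⟨r, rfl⟩ := Submodule.mkQ_surjective _ y
    exact ⟨⟨r, hy⟩, rfl⟩
  refine ⟨L, i, e.symm.toLinearMap ∘ₗ q', fun a b hab => ?_,
    e.symm.surjective.comp hq', fun l => ?_⟩
  · exact mul_right_cancel₀ hx0 (congrArg Subtype.val hab)
  · calc e.symm (q' l) = 0 ↔ x ∣ (l : R) := by
          rw [e.symm.map_eq_zero_iff, ← hker, ← Submodule.coe_eq_zero]
          rfl
      _ ↔ l ∈ Set.range i :=
          ⟨fun ⟨c, hc⟩ => ⟨c, Subtype.ext ((mul_comm c x).trans hc.symm)⟩,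
            fun ⟨c, hc⟩ => ⟨c, (congrArg Subtype.val hc).symm.trans (mul_comm c x)⟩⟩

lemma level_succ_of_maximalIdeal_smul_mem [IsGorensteinLocalRing R] (hR : ¬ IsField R)
    (hL : IsResidueExtension R L) (hLH : Gen (fun X => X = H) (toStable R L)) {j : N →ₗ[R] M}
    (hj : Function.Injective j) (hjM : ∀ r ∈ maximalIdeal R, ∀ v : M, r • v ∈ LinearMap.range j)
    (hN : level H k (toStable R N)) : level H (k + 1) (toStable R M) := by
  obtain ⟨i, q, hi, hq, hiq⟩ := hL
  have hkill : ∀ r ∈ maximalIdeal R, ∀ x : M ⧸ LinearMap.range j, r • x = 0 := fun r hr x => by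
    obtain ⟨v, rfl⟩ := Submodule.mkQ_surjective _ x
    rw [← map_smul, Submodule.mkQ_apply, Submodule.Quotient.mk_eq_zero]
    exact hjM r hr v
  obtain ⟨s, ⟨e⟩⟩ := exists_linearEquiv_pi_quotient (maximalIdeal R) hkill
  let p : M →ₗ[R] (Fin s → R ⧸ maximalIdeal R) := e.toLinearMap ∘ₗ (LinearMap.range j).mkQ
  have hp : Function.Surjective p := e.surjective.comp (Submodule.mkQ_surjective _)
  have hjp : Function.Exact j p := fun v => by simp [p]
  obtain ⟨f, g, hf, hg, hfg⟩ := exists_exact_of_pi_resolution hR hj hp hjp hi.comp_left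
    hq.comp_left (exact_compLeft hiq (Fin s))
  have hprod : level H (k + 1) (toStable R ((Fin s → R) × M)) :=
    level_succ_of_exact (X := toCM R N) (Y := toCM R ((Fin s → R) × M))
      (Z := toCM R (Fin s → L)) hf hg hfg hN (hLH.pi s)
  exact Gen.of_prod (X := toCM R M) (Y := toCM R (Fin s → R)) (LinearEquiv.prodComm R _ _) hprod

end Levels

section FiniteType

open Module

variable {R S : Type u} [CommRing R] [CommRing S] [Algebra R S]

lemma InAdd.restrictScalars {G M : Type u} [AddCommGroup G] [AddCommGroup M] [Module R G]
    [Module R M] [Module S G] [Module S M] [IsScalarTower R S G] [IsScalarTower R S M]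
    (h : InAdd (ModuleCat.of S G) (ModuleCat.of S M)) :
    InAdd (ModuleCat.of R G) (ModuleCat.of R M) := by
  obtain ⟨k, N, ⟨e⟩⟩ := h
  let : Module R N := Module.compHom N (algebraMap R S)
  have : IsScalarTower R S N := IsScalarTower.of_algebraMap_smul fun _ _ => rfl
  exact ⟨k, ModuleCat.of R N, ⟨e.restrictScalars R⟩⟩

lemma InAdd.refl {A : Type u} [CommRing A] (G : ModuleCat.{u} A) : InAdd G G :=
  ⟨1, ModuleCat.of A PUnit, ⟨LinearEquiv.prodUnique.trans (LinearEquiv.funUnique (Fin 1) A G).symm⟩⟩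

variable [IsDomain R] [IsDomain S] [Ring.DimensionLEOne R] [Module.Finite R S]
  [IsTorsionFree R S]

lemma CMFiniteType.exists_generator (h : CMFiniteType S) :
    ∃ (G : Type u) (_ : AddCommGroup G) (_ : Module R G),
      Module.Finite R G ∧ IsTorsionFree R G ∧
      ∀ (M : Type u) [AddCommGroup M] [Module R M] [Module S M] [IsScalarTower R S M]
        [Module.Finite S M] [IsTorsionFree S M], InAdd (ModuleCat.of R G) (ModuleCat.of R M) := by
  obtain ⟨G, hGfin, hG⟩ := h
  have : Ring.DimensionLEOne S := Ring.DimensionLEOne.of_isIntegral R S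
  have hGtf : IsTorsionFree S G := isTorsionFree_of_isCM ((hG G).2 (InAdd.refl G))
  let : Module R G := Module.compHom G (algebraMap R S)
  have : IsScalarTower R S G := IsScalarTower.of_algebraMap_smul fun _ _ => rfl
  exact ⟨G, inferInstance, inferInstance, Module.Finite.trans S G, IsTorsionFree.trans S,
    fun M _ _ _ _ _ _ => ((hG (ModuleCat.of S M)).1 (isCM_of_isTorsionFree M)).restrictScalars⟩

end FiniteType

/-! ### Lattices over the rings `iterEnd R n` -/

section Lattices

open Module

variable {R : Type u} [CommRing R]

section Rings

variable [IsLocalRing R] (S : Subalgebra R (FractionRing R))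

lemma algebraMap_mem_jacobson [Algebra.IsIntegral R S] {r : R} (hr : r ∈ maximalIdeal R) :
    algebraMap R S r ∈ Ring.jacobson S := by
  rw [Ring.jacobson_eq_sInf_isMaximal, Ideal.mem_sInf]
  intro I (hI : I.IsMaximal)
  have hcomap := Ideal.isMaximal_comap_of_isIntegral_of_isMaximal (R := R) I
  exact (IsLocalRing.eq_maximalIdeal hcomap).ge hr

variable [IsDomain R] [IsNoetherianRing R]

/- Multiplication by a nonzero element of the maximal ideal embeds `endMax S` in `S`. -/
lemma finite_endMax (hR : ¬ IsField R) [Module.Finite R S] : Module.Finite R (endMax S) := by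
  obtain ⟨x, hx, hx0⟩ := exists_ne_zero_mem_maximalIdeal hR
  have hxK : algebraMap R (FractionRing R) x ≠ 0 :=
    (map_ne_zero_iff _ (IsFractionRing.injective R (FractionRing R))).2 hx0
  let f : endMax S →ₗ[R] S :=
    (LinearMap.mulRight R (algebraMap R (FractionRing R) x) ∘ₗ
      (endMax S).val.toLinearMap).codRestrict S.toSubmodule fun t => by
        obtain ⟨z, -, hz⟩ := t.2 _ (algebraMap_mem_jacobson S hx)
        exact Set.mem_of_eq_of_mem hz.symm z.2
  exact Module.Finite.of_injective f fun a b hab =>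
    Subtype.ext (mul_right_cancel₀ hxK (congrArg Subtype.val hab))

lemma finite_iterEnd (hR : ¬ IsField R) (n : ℕ) : Module.Finite R (iterEnd R n) := by
  induction n with
  | zero => exact inferInstanceAs (Module.Finite R (⊥ : Subalgebra R (FractionRing R)))
  | succ n ih => exact finite_endMax _ hR

end Rings

variable {V : Type u} [AddCommGroup V] [Module (FractionRing R) V]

section JacobsonSMul

variable {S : Subalgebra R (FractionRing R)}

/-- The product of an `S`-lattice with the Jacobson radical `𝔫` of `S`, as a lattice over
`𝔫 : 𝔫`. -/
def jacobsonSMul (M : Submodule S V) : Submodule (endMax S) V where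
  __ := (Ring.jacobson S • M).toAddSubmonoid
  smul_mem' := fun s v (hv : v ∈ Ring.jacobson S • M) => by
    change s • v ∈ Ring.jacobson S • M
    refine Submodule.smul_induction_on hv (fun j hj w hw => ?_) fun x y hx hy => ?_
    · obtain ⟨z, hz, hzj⟩ := s.2 j hj
      have hsj : z • w = s • j • w := by
        rw [Subalgebra.smul_def, hzj, mul_smul]
        rfl
      exact hsj ▸ Submodule.smul_mem_smul hz hw
    · exact (smul_add s x y).symm ▸ add_mem hx hy

lemma mem_of_mem_jacobsonSMul {M : Submodule S V} {v : V} (hv : v ∈ jacobsonSMul M) : v ∈ M :=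
  (Submodule.smul_le_right : Ring.jacobson S • M ≤ M) hv

variable [Module R V] [IsScalarTower R (FractionRing R) V]

lemma smul_mem_jacobsonSMul [IsLocalRing R] [Algebra.IsIntegral R S] {M : Submodule S V} {r : R}
    (hr : r ∈ maximalIdeal R) {v : V} (hv : v ∈ M) : r • v ∈ jacobsonSMul M := by
  rw [← algebraMap_smul S r v]
  have h : algebraMap R S r • v ∈ Ring.jacobson S • M :=
    Submodule.smul_mem_smul (algebraMap_mem_jacobson S hr) hv
  exact h

end JacobsonSMul

variable [IsDomain R] [Module R V] [IsScalarTower R (FractionRing R) V]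

section Levels

instance (S : Subalgebra R (FractionRing R)) (M : Submodule S V) : IsTorsionFree R M :=
  have : IsTorsionFree R V := IsTorsionFree.trans (FractionRing R)
  inferInstanceAs (IsTorsionFree R (M.restrictScalars R))

variable [Ring.DimensionLEOne R] [IsGorensteinLocalRing R] {H : StableCM R} {L : Type u}
  [AddCommGroup L] [Module R L] [Module.Finite R L] [IsTorsionFree R L]

lemma level_succ_of_endMax (hR : ¬ IsField R) (hL : IsResidueExtension R L)
    (hLH : Gen (fun X => X = H) (toStable R L)) {S : Subalgebra R (FractionRing R)}
    [Module.Finite R S] {k : ℕ} (h : ∀ (N : Submodule (endMax S) V) [Module.Finite R N],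
      level H k (toStable R N)) (M : Submodule S V) [Module.Finite R M] :
    level H (k + 1) (toStable R M) := by
  let j : jacobsonSMul M →ₗ[R] M :=
    ((jacobsonSMul M).restrictScalars R).inclusion
      (p' := M.restrictScalars R) fun _ => mem_of_mem_jacobsonSMul
  have hj : Function.Injective j := Submodule.inclusion_injective _
  have : IsNoetherian R M := isNoetherian_of_isNoetherianRing_of_finite R M
  have := Module.Finite.of_injective j hj
  exact level_succ_of_maximalIdeal_smul_mem hR hL hLH hj
    (fun r hr v => ⟨⟨r • (v : V), smul_mem_jacobsonSMul hr v.2⟩, rfl⟩) (h _)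

lemma level_of_iterEnd (hR : ¬ IsField R) (hL : IsResidueExtension R L)
    (hLH : Gen (fun X => X = H) (toStable R L)) {l n : ℕ}
    (h : ∀ (N : Submodule (iterEnd R (n + l)) V) [Module.Finite R N], level H 1 (toStable R N))
    (M : Submodule (iterEnd R l) V) [Module.Finite R M] :
    level H (n + 1) (toStable R M) := by
  induction n generalizing l with
  | zero => exact (zero_add l ▸ h) M
  | succ n ih =>
    have := finite_iterEnd hR l
    exact level_succ_of_endMax hR hL hLH (ih (l := l + 1) (Nat.add_right_comm n 1 l ▸ h)) M

end Levels

section Reflexive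

lemma smul_mem_of_forall_dual {M : Submodule R V} [IsReflexive R M] {x : FractionRing R} {v : M}
    (h : ∀ f : Dual R M, ∃ c : R,
      algebraMap R (FractionRing R) c = x * algebraMap R (FractionRing R) (f v)) :
    x • (v : V) ∈ M := by
  have hinj := IsFractionRing.injective R (FractionRing R)
  choose c hc using h
  let ψ : Dual R (Dual R M) :=
    { toFun := c
      map_add' := fun f g => hinj (by simp [hc, mul_add])
      map_smul' := fun a f => hinj (by simp [hc, mul_left_comm]) }
  obtain ⟨w, hw⟩ := (bijective_dual_eval R M).2 ψ
  obtain ⟨a, b, hb, rfl⟩ := IsFractionRing.div_surjective (A := R) x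
  have hbK : algebraMap R (FractionRing R) b ≠ 0 :=
    (map_ne_zero_iff _ hinj).2 (nonZeroDivisors.ne_zero hb)
  have hab : b • w = a • v := (bijective_dual_eval R M).1 <| by
    ext f
    have hfw : f w = c f := LinearMap.congr_fun hw f
    refine hinj ?_
    change algebraMap R (FractionRing R) (f (b • w)) = algebraMap R (FractionRing R) (f (a • v))
    rw [f.map_smul, f.map_smul, hfw, smul_eq_mul, smul_eq_mul, map_mul, map_mul, hc, ← mul_assoc,
      mul_div_cancel₀ _ hbK]
  have hw' : (algebraMap R (FractionRing R) a / algebraMap R (FractionRing R) b) • (v : V) = w := by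
    rw [div_eq_inv_mul, mul_smul, inv_smul_eq_iff₀ hbK, algebraMap_smul, algebraMap_smul]
    exact (congrArg Subtype.val hab).symm
  exact hw' ▸ w.2

variable [IsGorensteinLocalRing R] [Ring.DimensionLEOne R]

/- All functionals on `M` take values in the maximal ideal `𝔪`, so multiplication by an element of
`𝔪 : 𝔪` acts on the double dual of `M`. -/
lemma exists_restrictScalars_eq_of_not_surjective (hR : ¬ IsField R) (M : Submodule R V)
    [Module.Finite R M] (hM : ∀ f : M →ₗ[R] R, ¬ Function.Surjective f) :
    ∃ M' : Submodule (iterEnd R 1) V, M'.restrictScalars R = M := by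
  have : IsTorsionFree R V := IsTorsionFree.trans (FractionRing R)
  have : IsReflexive R M := isReflexive_of_isTorsionFree hR M
  have := finite_iterEnd hR 0
  refine ⟨{ M with smul_mem' := fun s v hv => smul_mem_of_forall_dual (v := ⟨v, hv⟩) fun f => ?_ },
    rfl⟩
  have hf : f ⟨v, hv⟩ ∈ maximalIdeal R :=
    IsLocalRing.le_maximalIdeal (mt LinearMap.range_eq_top.1 (hM f)) (LinearMap.mem_range_self f _)
  obtain ⟨z, -, hz⟩ := s.2 _ (algebraMap_mem_jacobson (iterEnd R 0) hf)
  obtain ⟨c, hc⟩ := Algebra.mem_bot.1 z.2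
  exact ⟨c, hc.trans hz⟩

lemma exists_linearEquiv_iterEnd_one (hR : ¬ IsField R) (M : Type*) [AddCommGroup M] [Module R M]
    [Module.Finite R M] [IsTorsionFree R M] (hM : ∀ f : M →ₗ[R] R, ¬ Function.Surjective f) :
    ∃ (d : ℕ) (M' : Submodule (iterEnd R 1) (Fin d → FractionRing R)), Nonempty (M ≃ₗ[R] M') := by
  obtain ⟨d, f, hf⟩ := exists_injective_fin_pi R M
  let g := (Algebra.linearMap R (FractionRing R)).compLeft (Fin d) ∘ₗ f
  have hg : Function.Injective g := (IsFractionRing.injective R (FractionRing R)).comp_left.comp hf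
  let e := LinearEquiv.ofInjective g hg
  obtain ⟨M', hM'⟩ := exists_restrictScalars_eq_of_not_surjective hR (LinearMap.range g)
    fun a ha => hM (a ∘ₗ e.toLinearMap) (ha.comp e.surjective)
  exact ⟨d, M', ⟨e.trans (LinearEquiv.ofEq _ _ hM'.symm)⟩⟩

/- Free summands vanish in the stable category, and what remains of `M` is a lattice over
`iterEnd R 1`. -/
lemma level_of_forall_iterEnd_one (hR : ¬ IsField R) {H : StableCM R} {k : ℕ} {M : Type u}
    [AddCommGroup M] [Module R M] [Module.Finite R M] [IsTorsionFree R M]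
    (h : ∀ (d : ℕ) (N : Submodule (iterEnd R 1) (Fin d → FractionRing R)) [Module.Finite R N],
      level H (k + 1) (toStable R N)) : level H (k + 1) (toStable R M) := by
  obtain ⟨r, N, hN, ⟨e⟩⟩ := exists_linearEquiv_prod_pi (R := R) M
  obtain ⟨d, N', ⟨e'⟩⟩ := exists_linearEquiv_iterEnd_one hR N hN
  have : Module.Finite R N' := Module.Finite.equiv e'
  exact Gen.prod (X := toCM R N') (Y := toCM R (Fin r → R)) (Z := toCM R M)
    (e.trans (e'.prodCongr (LinearEquiv.refl R _))) (h d N')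
    (Gen.zero _ isZero_toStable_of_projective)

end Reflexive

end Lattices

lemma not_isField_of_ringKrullDim_eq_one {R : Type*} [CommRing R] (h : ringKrullDim R = 1) :
    ¬ IsField R := fun hR =>
  zero_ne_one ((ringKrullDim_eq_zero_of_isField hR).symm.trans h)

lemma dimensionLEOne_of_ringKrullDim_le_one {R : Type*} [CommRing R] [IsDomain R]
    (h : ringKrullDim R ≤ 1) : Ring.DimensionLEOne R :=
  ⟨fun {p} hp0 hp =>
    Ring.krullDimLE_one_iff_of_isPrime_bot.1 (Ring.krullDimLE_iff.2 h) p hp0 hp⟩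

end CMStable

end

open CMStable in
theorem proposition3p1_general {R : Type u} [CommRing R] [IsDomain R] [IsGorensteinLocalRing R]
    (hdim : ringKrullDim R = 1) (n : ℕ) (hfin : CMFiniteType (iterEnd R (n + 1))) :
    stableDim R ≤ n := by
  have hR := not_isField_of_ringKrullDim_eq_one hdim
  have := dimensionLEOne_of_ringKrullDim_le_one hdim.le
  have := finite_iterEnd hR (n + 1)
  obtain ⟨G, _, _, _, _, hG⟩ := hfin.exists_generator (R := R)
  obtain ⟨L, hL⟩ := exists_ideal_isResidueExtension hR
  let H := toStable R (G × L)
  have hGH : Gen (fun X => X = H) (toStable R G) :=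
    Gen.of_prod (X := toCM R G) (Y := toCM R L) (LinearEquiv.refl R (G × L)) (Gen.of H rfl)
  have hLH : Gen (fun X => X = H) (toStable R L) :=
    Gen.of_prod (X := toCM R L) (Y := toCM R G) (LinearEquiv.prodComm R G L) (Gen.of H rfl)
  refine iInf₂_le n ⟨H, fun X => ?_⟩
  obtain ⟨_, _⟩ := isCM_iff.1 X.as.property
  refine level_of_forall_iterEnd_one hR (M := X.as.obj) fun d M _ =>
    level_of_iterEnd hR hL hLH (fun N _ => ?_) M
  have : Module.IsTorsionFree (iterEnd R (n + 1)) (Fin d → FractionRing R) :=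
    Module.IsTorsionFree.trans (FractionRing R)
  have : Module.Finite (iterEnd R (n + 1)) N :=
    Module.Finite.of_restrictScalars_finite R (iterEnd R (n + 1)) N
  exact level_one_of_gen (Gen.of_inAdd (hG N) hGH)

theorem proposition3p1 {R : Type u} [CommRing R] [IsDomain R] [CMStable.IsGorensteinLocalRing R]
    [IsAdicComplete (IsLocalRing.maximalIdeal R) R]
    (hdim : ringKrullDim R = 1) (hsing : ¬ IsRegularLocalRing R)
    (n : ℕ) (hn : 1 ≤ n) (hfin : CMStable.CMFiniteType (CMStable.iterEnd R n)) :
    CMStable.stableDim R ≤ ((n - 1 : ℕ) : ℕ∞) :=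
  proposition3p1_general hdim (n - 1) (by rwa [Nat.sub_add_cancel hn])
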